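/- **Theorem (Sharp $L^2$ constant for the $|\xi|^{-1}$ Fourier weight).** Let $D\subset\mathbb R^2$ be a bounded (Lebesgue) measurable set, and let $L^2(D)$ be the space of complex-valued square-integrable functions on $D$. For $f\in L^2(D)$, extended by $0$ to $\mathbb R^2$, put $$\widehat f(\xi)=\frac1{2\pi}\int_{\mathbb R^2}e^{-ix\cdot\xi}f(x)\,dx .$$ Then the formula $$(S_Df)(x)=\int_D\frac{f(y)}{|x-y|}\,dy\qquad(\text{for a.e. }x\in D)$$ defines a bounded linear operator $S_D:L^2(D)\to L^2(D)$ (the integral converging absolutely for a.e. $x\in D$), which is positive, self-adjoint and compact, and for every $f\in L^2(D)$ $$\int_{\mathbb R^2}\frac{|\widehat f(\xi)|^2}{|\xi|}\,d\xi=\frac1{2\pi}\langle S_Df,f\rangle_{L^2(D)}<\infty .$$ Consequently, the sharp constant $C_{\mathrm{sharp}}(D)$, that is, the least $C\ge 0$ such that $$\int_{\mathbb R^2}\frac{|\widehat f(\xi)|^2}{|\xi|}\,d\xi\le C\,\|f\|_{L^2(D)}^2\qquad\text{for all } f\in L^2(D),$$ exists and equals $\frac1{2\pi}\|S_D\|_{L^2(D)\to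 L^2(D)}$. If $D$ has positive measure, then $\|S_D\|=\lambda_{\max}(S_D)$ is the largest eigenvalue of $S_D$, so that $$C_{\mathrm{sharp}}(D)=\frac1{2\pi}\|S_D\|=\frac1{2\pi}\lambda_{\max}(S_D).$$ Moreover, $$C_{\mathrm{sharp}}(D)\le\frac1{2\pi}\sup_{x\in D}\int_D\frac{dy}{|x-y|}<\infty ,$$ where the supremum is read as $0$ if $D$ is empty. -/

import Mathlib

open MeasureTheory

noncomputable section

namespace RieszFourier

/-- The Euclidean plane `ℝ²`. -/
abbrev Plane : Type := EuclideanSpace ℝ (Fin 2)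

/-- The complex Hilbert space `L²(D)` with respect to Lebesgue measure on `D`. -/
abbrev L2 (D : Set Plane) : Type := Lp ℂ 2 (volume.restrict D)

/-- The extension of `f ∈ L²(D)` by zero to the whole plane. -/
def zeroExt (D : Set Plane) (f : L2 D) : Plane → ℂ := D.indicator f

/-- The Fourier transform `(2π)⁻¹ ∫ e^{-i x·ξ} g(x) dx` on the plane. It is applied below only to
square-integrable functions vanishing off a bounded set, for which the integral converges
absolutely. -/
def fourier (g : Plane → ℂ) (ξ : Plane) : ℂ :=
  (1 / (2 * Real.pi) : ℂ) * ∫ x : Plane, Complex.exp (-Complex.I * (inner ℝ x ξ : ℝ)) * g x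

/-- The integrand `|f̂(ξ)|² / |ξ|`, where `f` is extended by zero. -/
def energyDensity (D : Set Plane) (f : L2 D) (ξ : Plane) : ℝ :=
  ‖fourier (zeroExt D f) ξ‖ ^ 2 / ‖ξ‖

/-- `S` is the integral operator on `L²(D)` with kernel `1 / |x - y|`: for every `f ∈ L²(D)` and
almost every `x ∈ D`, the integral `∫_D f(y) / |x - y| dy` converges absolutely and equals
`(S f)(x)`. This determines `S`. -/
def IsRieszOperator (D : Set Plane) (S : L2 D →L[ℂ] L2 D) : Prop :=
  ∀ f : L2 D, ∀ᵐ x ∂(volume.restrict D),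
    IntegrableOn (fun y : Plane => f y / (‖x - y‖ : ℂ)) D ∧
      S f x = ∫ y in D, f y / (‖x - y‖ : ℂ)

/-- The constants `C ≥ 0` with `∫ |f̂(ξ)|² / |ξ| dξ ≤ C ‖f‖²` for all `f ∈ L²(D)`, the integral
being finite. (The sign of `C` matters only if `D` is a null set, when `L²(D) = 0`.) -/
def admissibleConstants (D : Set Plane) : Set ℝ :=
  {C | 0 ≤ C ∧ ∀ f : L2 D,
    Integrable (energyDensity D f) ∧ ∫ ξ, energyDensity D f ξ ≤ C * ‖f‖ ^ 2}

/-- `C` is the sharp (least admissible) constant. -/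
def IsSharpConstant (D : Set Plane) (C : ℝ) : Prop := IsLeast (admissibleConstants D) C

/-- `l` is the largest eigenvalue of `S`, that is, the greatest of its real eigenvalues. -/
def IsMaxEigenvalue {D : Set Plane} (S : L2 D →L[ℂ] L2 D) (l : ℝ) : Prop :=
  IsGreatest {t : ℝ | Module.End.HasEigenvalue (S : L2 D →ₗ[ℂ] L2 D) (t : ℂ)} l

/-- The function `x ↦ ∫_D dy / |x - y|`. -/
def rieszPotential (D : Set Plane) (x : Plane) : ℝ := ∫ y in D, 1 / ‖x - y‖

end RieszFourier

end

/-! In the plane the Fourier transform of `|ξ|⁻¹` is a multiple of `|x|⁻¹`, so the weighted energy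
is the quadratic form of the kernel `1 / |x - y|`. Subordination to Gaussians makes this rigorous:
`|ξ|⁻¹` is `2 / √π` times the integral of `exp (-u² |ξ|²)` over `u > 0`. For fixed `u` Fubini turns
the Gaussian-weighted energy into a double integral of `f(x) conj f(y)` against `heatProfile`, and
integrating over `u` gives `π √π / |x - y|`. Hence `integrable_and_integral_norm_sq_fourierOf`; with
the factor `(2π)⁻²` of the normalized transform the energy is `(2π)⁻¹ ⟨S f, f⟩`.

The form is therefore real and nonnegative, so `S` is positive, in particular self-adjoint. Schur's
test, with row and column integrals bounded by the potential, gives existence and the norm bound. It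
also shows that `S` is a norm limit of finite-rank operators, hence compact. By Cauchy–Schwarz `‖S‖
/ 2π` is admissible; it is least because `‖S‖` is an eigenvalue (`hasEigenvalue_norm`), whose
eigenvector attains equality. -/

namespace RieszFourier

open scoped ENNReal NNReal

/-! ### Schur's test and integral operators on `L²`. -/

section Schur

variable {α : Type*} [MeasurableSpace α] {μ : Measure α}

/-- The weighted Cauchy–Schwarz inequality. -/
lemma lintegral_mul_sq_le {k g : α → ℝ≥0∞} (hk : AEMeasurable k μ) (hg : AEMeasurable g μ) :
    (∫⁻ y, k y * g y ∂μ) ^ 2 ≤ (∫⁻ y, k y ∂μ) * ∫⁻ y, k y * g y ^ 2 ∂μ := by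
  -- Hölder for the splitting `k g = k^(1/2) · (k^(1/2) g)`.
  have h := ENNReal.lintegral_mul_le_Lp_mul_Lq μ Real.HolderConjugate.two_two
    (hk.pow_const (1 / 2 : ℝ)) ((hk.pow_const (1 / 2 : ℝ)).mul hg)
  have e : ∀ a : ℝ≥0∞, a ^ (1 / 2 : ℝ) * a ^ (1 / 2 : ℝ) = a := fun a => by
    rw [← ENNReal.rpow_add_of_nonneg _ _ (by norm_num) (by norm_num)]; norm_num
  have e' : ∀ a : ℝ≥0∞, (a ^ (1 / 2 : ℝ)) ^ 2 = a := fun a => by rw [sq, e]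
  simp only [Pi.mul_apply, ENNReal.rpow_two, mul_pow, e', ← mul_assoc, e] at h
  calc _ ≤ _ := pow_le_pow_left' h 2
    _ = _ := by rw [mul_pow, e', e']

/-- Schur's test, in terms of Lebesgue integrals of nonnegative functions. -/
lemma lintegral_lintegral_mul_sq_le [SFinite μ] {k : α → α → ℝ≥0∞}
    (hk : Measurable (Function.uncurry k)) {A : ℝ≥0∞}
    (hrow : ∀ᵐ x ∂μ, ∫⁻ y, k x y ∂μ ≤ A) (hcol : ∀ᵐ y ∂μ, ∫⁻ x, k x y ∂μ ≤ A)
    {g : α → ℝ≥0∞} (hg : AEMeasurable g μ) :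
    ∫⁻ x, (∫⁻ y, k x y * g y ∂μ) ^ 2 ∂μ ≤ A ^ 2 * ∫⁻ y, g y ^ 2 ∂μ := by
  have hg2 : AEMeasurable (fun y => g y ^ 2) μ := hg.pow_const 2
  have hm : AEMeasurable (Function.uncurry fun x y => k x y * g y ^ 2) (μ.prod μ) :=
    hk.aemeasurable.mul (hg2.comp_quasiMeasurePreserving Measure.quasiMeasurePreserving_snd)
  have hkl : ∀ x, Measurable (k x) := fun x => hk.comp measurable_prodMk_left
  have hkr : ∀ y, Measurable fun x => k x y := fun y => hk.comp measurable_prodMk_right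
  calc ∫⁻ x, (∫⁻ y, k x y * g y ∂μ) ^ 2 ∂μ
      ≤ ∫⁻ x, A * ∫⁻ y, k x y * g y ^ 2 ∂μ ∂μ := by
        refine lintegral_mono_ae (hrow.mono fun x hx => ?_)
        exact (lintegral_mul_sq_le (hkl x).aemeasurable hg).trans (mul_le_mul_left hx _)
    _ = A * ∫⁻ y, ∫⁻ x, k x y * g y ^ 2 ∂μ ∂μ := by
        rw [lintegral_const_mul'' _ (f := fun x => ∫⁻ y, k x y * g y ^ 2 ∂μ)
          hm.lintegral_prod_right', lintegral_lintegral_swap hm]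
    _ ≤ A * ∫⁻ y, A * g y ^ 2 ∂μ := by
        refine mul_le_mul_right ?_ A
        refine lintegral_mono_ae (hcol.mono fun y hy => ?_)
        rw [lintegral_mul_const _ (hkr y)]
        exact mul_le_mul_left hy _
    _ = A ^ 2 * ∫⁻ y, g y ^ 2 ∂μ := by
        rw [lintegral_const_mul'' _ hg2, sq, mul_assoc]

/-- `T` is the integral operator on `L²(μ)` with kernel `k`. -/
def IsIntegralOperator (μ : Measure α) (k : α → α → ℝ) (T : Lp ℂ 2 μ →L[ℂ] Lp ℂ 2 μ) : Prop :=
  ∀ f : Lp ℂ 2 μ, ∀ᵐ x ∂μ, Integrable (fun y => f y * (k x y : ℂ)) μ ∧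
    T f x = ∫ y, f y * (k x y : ℂ) ∂μ

lemma IsIntegralOperator.sub {k l : α → α → ℝ} {T U : Lp ℂ 2 μ →L[ℂ] Lp ℂ 2 μ}
    (hT : IsIntegralOperator μ k T) (hU : IsIntegralOperator μ l U) :
    IsIntegralOperator μ (fun x y => k x y - l x y) (T - U) := by
  intro f
  filter_upwards [hT f, hU f, Lp.coeFn_sub (T f) (U f)] with x h₁ h₂ h₃
  have e : (fun y => f y * ((k x y - l x y : ℝ) : ℂ)) =
      fun y => f y * (k x y : ℂ) - f y * (l x y : ℂ) := by
    funext y; push_cast; ring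
  rw [e, integral_sub h₁.1 h₂.1]
  refine ⟨h₁.1.sub h₂.1, ?_⟩
  rw [_root_.sub_apply, h₃, Pi.sub_apply, h₁.2, h₂.2]

lemma eLpNorm_two_sq {E : Type*} [NormedAddCommGroup E] (f : α → E) :
    eLpNorm f 2 μ ^ 2 = ∫⁻ x, ‖f x‖ₑ ^ 2 ∂μ := by
  have := eLpNorm_nnreal_pow_eq_lintegral (f := f) (μ := μ) (p := 2) (by norm_num)
  simpa using this

lemma eLpNorm_integral_mul_le [SFinite μ] {k : α → α → ℝ}
    (hk : Measurable (Function.uncurry k)) {A : ℝ≥0∞}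
    (hrow : ∀ᵐ x ∂μ, ∫⁻ y, ‖k x y‖ₑ ∂μ ≤ A) (hcol : ∀ᵐ y ∂μ, ∫⁻ x, ‖k x y‖ₑ ∂μ ≤ A)
    {f : α → ℂ} (hf : AEStronglyMeasurable f μ) :
    eLpNorm (fun x => ∫ y, f y * (k x y : ℂ) ∂μ) 2 μ ≤ A * eLpNorm f 2 μ := by
  rw [← ENNReal.pow_le_pow_left_iff two_ne_zero, mul_pow, eLpNorm_two_sq, eLpNorm_two_sq]
  refine le_trans (lintegral_mono fun x => ?_)
    (lintegral_lintegral_mul_sq_le (k := fun x y => ‖k x y‖ₑ) hk.enorm hrow hcol hf.enorm)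
  refine pow_le_pow_left' ((enorm_integral_le_lintegral_enorm _).trans_eq ?_) 2
  refine lintegral_congr fun y => ?_
  rw [enorm_mul, mul_comm]
  simp [enorm_eq_nnnorm]

/-- Serves twice: for the potential bound on `‖S‖`, and for the smallness of the error in the
finite-rank approximation. -/
lemma IsIntegralOperator.norm_le [SFinite μ] {k : α → α → ℝ}
    (hk : Measurable (Function.uncurry k)) {A : ℝ} (hA : 0 ≤ A)
    (hrow : ∀ᵐ x ∂μ, ∫⁻ y, ‖k x y‖ₑ ∂μ ≤ ENNReal.ofReal A)
    (hcol : ∀ᵐ y ∂μ, ∫⁻ x, ‖k x y‖ₑ ∂μ ≤ ENNReal.ofReal A)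
    {T : Lp ℂ 2 μ →L[ℂ] Lp ℂ 2 μ} (hT : IsIntegralOperator μ k T) : ‖T‖ ≤ A := by
  refine T.opNorm_le_bound hA fun f => ?_
  have h := eLpNorm_integral_mul_le hk hrow hcol (Lp.aestronglyMeasurable f)
  rw [← eLpNorm_congr_ae ((hT f).mono fun x hx => hx.2)] at h
  have := ENNReal.toReal_mono (ENNReal.mul_ne_top ENNReal.ofReal_ne_top (Lp.eLpNorm_ne_top f)) h
  rwa [ENNReal.toReal_mul, ENNReal.toReal_ofReal hA, ← Lp.norm_def, ← Lp.norm_def] at this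

lemma ae_integrable_mul_kernel [SFinite μ] {k : α → α → ℝ}
    (hk : Measurable (Function.uncurry k)) {A : ℝ}
    (hrow : ∀ᵐ x ∂μ, ∫⁻ y, ‖k x y‖ₑ ∂μ ≤ ENNReal.ofReal A)
    (hcol : ∀ᵐ y ∂μ, ∫⁻ x, ‖k x y‖ₑ ∂μ ≤ ENNReal.ofReal A) (f : Lp ℂ 2 μ) :
    ∀ᵐ x ∂μ, Integrable (fun y => f y * (k x y : ℂ)) μ := by
  have hf := (Lp.aestronglyMeasurable f)
  have h := lintegral_lintegral_mul_sq_le (k := fun x y => ‖k x y‖ₑ) hk.enorm hrow hcol hf.enorm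
  rw [← eLpNorm_two_sq] at h
  have hm : AEMeasurable (Function.uncurry fun x y => ‖k x y‖ₑ * ‖f y‖ₑ) (μ.prod μ) :=
    hk.enorm.aemeasurable.mul
      (hf.enorm.comp_quasiMeasurePreserving Measure.quasiMeasurePreserving_snd)
  have hfin := ae_lt_top' (hm.lintegral_prod_right'.pow_const 2) (h.trans_lt (ENNReal.mul_lt_top
    (by simp) (ENNReal.pow_lt_top (Lp.eLpNorm_lt_top f)))).ne
  filter_upwards [hfin] with x hx
  have hkx : Measurable (k x) := hk.comp measurable_prodMk_left
  refine ⟨hf.mul (by fun_prop), ?_⟩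
  have hx' : ∫⁻ y, ‖k x y‖ₑ * ‖f y‖ₑ ∂μ < ∞ := by
    by_contra hc
    simp only [not_lt, top_le_iff] at hc
    simp [Function.uncurry, hc] at hx
  refine lt_of_le_of_lt (le_of_eq (lintegral_congr fun y => ?_)) hx'
  rw [enorm_mul, mul_comm]
  simp [enorm_eq_nnnorm]

/-- A kernel satisfying the conditions of Schur's test defines a bounded operator. -/
lemma exists_isIntegralOperator [SFinite μ] {k : α → α → ℝ}
    (hk : Measurable (Function.uncurry k)) {A : ℝ} (hA : 0 ≤ A)
    (hrow : ∀ᵐ x ∂μ, ∫⁻ y, ‖k x y‖ₑ ∂μ ≤ ENNReal.ofReal A)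
    (hcol : ∀ᵐ y ∂μ, ∫⁻ x, ‖k x y‖ₑ ∂μ ≤ ENNReal.ofReal A) :
    ∃ T : Lp ℂ 2 μ →L[ℂ] Lp ℂ 2 μ, IsIntegralOperator μ k T := by
  have hint := ae_integrable_mul_kernel hk hrow hcol
  have hle := fun f : Lp ℂ 2 μ =>
    eLpNorm_integral_mul_le hk hrow hcol (Lp.aestronglyMeasurable f)
  have hmem : ∀ f : Lp ℂ 2 μ, MemLp (fun x => ∫ y, f y * (k x y : ℂ) ∂μ) 2 μ := fun f => by
    refine ⟨?_, (hle f).trans_lt (ENNReal.mul_lt_top (by simp) (Lp.eLpNorm_lt_top f))⟩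
    have hm : AEStronglyMeasurable (fun p : α × α => f p.2 * (k p.1 p.2 : ℂ)) (μ.prod μ) :=
      (Lp.aestronglyMeasurable f).comp_snd.mul
        (Complex.measurable_ofReal.comp hk).aestronglyMeasurable
    exact hm.integral_prod_right'
  let L : Lp ℂ 2 μ →ₗ[ℂ] Lp ℂ 2 μ :=
    { toFun := fun f => (hmem f).toLp
      map_add' := fun f g => by
        rw [← MemLp.toLp_add (hmem f) (hmem g), MemLp.toLp_eq_toLp_iff]
        filter_upwards [hint f, hint g] with x hf hg
        rw [Pi.add_apply, ← integral_add hf hg]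
        refine integral_congr_ae ?_
        filter_upwards [Lp.coeFn_add f g] with y hy
        rw [hy, Pi.add_apply, add_mul]
      map_smul' := fun c f => by
        rw [RingHom.id_apply, ← MemLp.toLp_const_smul c (hmem f), MemLp.toLp_eq_toLp_iff]
        refine Filter.Eventually.of_forall fun x => ?_
        rw [Pi.smul_apply, ← integral_smul]
        refine integral_congr_ae ?_
        filter_upwards [Lp.coeFn_smul c f] with y hy
        rw [hy, Pi.smul_apply, smul_mul_assoc] }
  refine ⟨L.mkContinuous A fun f => ?_, fun f => ?_⟩
  · change ‖(hmem f).toLp‖ ≤ _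
    rw [Lp.norm_toLp, Lp.norm_def, ← ENNReal.toReal_ofReal hA, ← ENNReal.toReal_mul]
    exact ENNReal.toReal_mono (ENNReal.mul_ne_top ENNReal.ofReal_ne_top (Lp.eLpNorm_ne_top f))
      (hle f)
  · filter_upwards [hint f, (hmem f).coeFn_toLp] with x h₁ h₂
    exact ⟨h₁, h₂⟩

/-- The quadratic form of an integral operator is an absolutely convergent double integral. -/
lemma integrable_prod_mul_kernel [SFinite μ] {k : α → α → ℝ}
    (hk : Measurable (Function.uncurry k)) {A : ℝ}
    (hrow : ∀ᵐ x ∂μ, ∫⁻ y, ‖k x y‖ₑ ∂μ ≤ ENNReal.ofReal A)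
    (hcol : ∀ᵐ y ∂μ, ∫⁻ x, ‖k x y‖ₑ ∂μ ≤ ENNReal.ofReal A) (f : Lp ℂ 2 μ) :
    Integrable (fun p : α × α => f p.1 * starRingEnd ℂ (f p.2) * (k p.1 p.2 : ℂ))
      (μ.prod μ) := by
  have hf := (Lp.aestronglyMeasurable f)
  have hm : AEStronglyMeasurable
      (fun p : α × α => f p.1 * starRingEnd ℂ (f p.2) * (k p.1 p.2 : ℂ)) (μ.prod μ) :=
    (hf.comp_fst.mul (Complex.continuous_conj.comp_aestronglyMeasurable hf.comp_snd)).mul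
        (Complex.measurable_ofReal.comp hk).aestronglyMeasurable
  refine ⟨hm, ?_⟩
  have h := lintegral_lintegral_mul_sq_le (k := fun x y => ‖k x y‖ₑ) hk.enorm hrow hcol hf.enorm
  rw [← eLpNorm_two_sq] at h
  have hkm : AEMeasurable (Function.uncurry fun x y => ‖k x y‖ₑ * ‖f y‖ₑ) (μ.prod μ) :=
    hk.enorm.aemeasurable.mul
      (hf.enorm.comp_quasiMeasurePreserving Measure.quasiMeasurePreserving_snd)
  -- Pairs `|f|` with `∫ |k(x, y)| |f(y)| dy`, which Schur's test places in `L²`.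
  have hH := ENNReal.lintegral_mul_le_Lp_mul_Lq μ Real.HolderConjugate.two_two
    hf.enorm hkm.lintegral_prod_right'
  simp only [Pi.mul_apply, ENNReal.rpow_two, ← eLpNorm_two_sq] at hH
  rw [hasFiniteIntegral_iff_enorm, lintegral_prod _ hm.enorm]
  refine lt_of_le_of_lt (le_trans (le_of_eq (lintegral_congr fun x => ?_)) hH)
    (ENNReal.mul_lt_top (ENNReal.rpow_lt_top_of_nonneg (by norm_num)
      (ENNReal.pow_lt_top (Lp.eLpNorm_lt_top f)).ne)
      (ENNReal.rpow_lt_top_of_nonneg (by norm_num) (h.trans_lt (ENNReal.mul_lt_top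
    (by simp) (ENNReal.pow_lt_top (Lp.eLpNorm_lt_top f)))).ne))
  rw [← lintegral_const_mul' _ _ enorm_ne_top]
  refine lintegral_congr fun y => ?_
  simp only [enorm_mul, Function.uncurry, RCLike.enorm_conj]
  rw [mul_assoc, mul_comm ‖f y‖ₑ]
  simp [enorm_eq_nnnorm]

/-- The inner product conjugates its first argument `T f`; since `k` is real, only `f p.2` gets
conjugated. -/
lemma IsIntegralOperator.inner_eq [SFinite μ] {k : α → α → ℝ}
    (hk : Measurable (Function.uncurry k)) {A : ℝ}
    (hrow : ∀ᵐ x ∂μ, ∫⁻ y, ‖k x y‖ₑ ∂μ ≤ ENNReal.ofReal A)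
    (hcol : ∀ᵐ y ∂μ, ∫⁻ x, ‖k x y‖ₑ ∂μ ≤ ENNReal.ofReal A)
    {T : Lp ℂ 2 μ →L[ℂ] Lp ℂ 2 μ} (hT : IsIntegralOperator μ k T) (f : Lp ℂ 2 μ) :
    inner ℂ (T f) f =
      ∫ p : α × α, f p.1 * starRingEnd ℂ (f p.2) * (k p.1 p.2 : ℂ) ∂(μ.prod μ) := by
  rw [L2.inner_def, integral_prod _ (integrable_prod_mul_kernel hk hrow hcol f)]
  refine integral_congr_ae ((hT f).mono fun x hx => ?_)
  simp only [RCLike.inner_apply, mul_assoc]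
  rw [hx.2, integral_const_mul, ← integral_conj]
  simp

end Schur

end RieszFourier

namespace RieszFourier

open scoped ENNReal NNReal
open Metric Filter Topology

/-! ### Local integrability of the kernel and the potential. -/

section Potential

/-- The kernel `1 / |x - y|`. -/
noncomputable def rieszKernel (x y : Plane) : ℝ := ‖x - y‖⁻¹

lemma measurable_rieszKernel : Measurable (Function.uncurry rieszKernel) := by
  unfold rieszKernel Function.uncurry; fun_prop

lemma rieszKernel_comm (x y : Plane) : rieszKernel x y = rieszKernel y x := by
  simp [rieszKernel, norm_sub_rev]

/-- The singularity has order 1, less than the dimension 2. -/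
lemma lintegral_ball_rieszKernel_lt_top (r : ℝ) :
    ∫⁻ z in ball (0 : Plane) r, ‖‖z‖⁻¹‖ₑ < ∞ := by
  have h : IntegrableOn (fun z : Plane => ‖z‖⁻¹) (ball 0 r) :=
    integrableOn_ball_of_norm_le_rpow (C := 1) (α := 1) (by simp) (by simp)
      (ae_of_all _ fun z => by simp [Real.rpow_neg_one])
      (by fun_prop)
  exact h.2

lemma setLIntegral_ball_rieszKernel (x : Plane) (r : ℝ) :
    ∫⁻ y in ball x r, ‖rieszKernel x y‖ₑ = ∫⁻ z in ball (0 : Plane) r, ‖‖z‖⁻¹‖ₑ := by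
  rw [← lintegral_indicator measurableSet_ball, ← lintegral_indicator measurableSet_ball,
    ← lintegral_sub_left_eq_self ((ball (0 : Plane) r).indicator _) x]
  refine lintegral_congr fun y => ?_
  simp only [Set.indicator, mem_ball, rieszKernel, dist_eq_norm, norm_sub_rev y x, sub_zero]

/-- Absolute continuity of the integral. By translation invariance the smallness is uniform in the
centre of the ball. -/
lemma exists_lintegral_ball_le {ε : ℝ≥0∞} (hε : ε ≠ 0) :
    ∃ r : ℝ, 0 < r ∧ ∫⁻ z in ball (0 : Plane) r, ‖‖z‖⁻¹‖ₑ ≤ ε := by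
  obtain ⟨δ, hδ, h⟩ := exists_pos_setLIntegral_lt_of_measure_lt
    (lintegral_ball_rieszKernel_lt_top 1).ne hε
  have ht : Tendsto (fun r : ℝ => volume (ball (0 : Plane) r)) (𝓝 0) (𝓝 0) := by
    simp only [EuclideanSpace.volume_ball_fin_two]
    have : Tendsto (fun r : ℝ => ENNReal.ofReal r ^ 2 * ENNReal.ofReal Real.pi) (𝓝 0)
        (𝓝 (ENNReal.ofReal 0 ^ 2 * ENNReal.ofReal Real.pi)) :=
      ENNReal.Tendsto.mul_const
        (ENNReal.Tendsto.pow (ENNReal.tendsto_ofReal tendsto_id)) (Or.inr (by simp))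
    simpa using! this
  have hev : ∀ᶠ r : ℝ in 𝓝[>] 0, volume (ball (0 : Plane) r) < δ :=
    (ht.mono_left nhdsWithin_le_nhds).eventually_lt_const hδ
  obtain ⟨r, ⟨hr, hr1⟩, hr0⟩ := ((hev.and (nhdsWithin_le_nhds
    (eventually_le_nhds zero_lt_one))).and self_mem_nhdsWithin).exists
  refine ⟨r, hr0, ?_⟩
  have := h (ball 0 r) ((Measure.restrict_apply_le _ _).trans_lt hr)
  rw [Measure.restrict_restrict measurableSet_ball,
    Set.inter_eq_left.mpr (ball_subset_ball hr1)] at this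
  exact this.le

lemma exists_lintegral_rieszKernel_le {D : Set Plane} (hD : Bornology.IsBounded D) :
    ∃ B : ℝ, 0 ≤ B ∧ ∀ x ∈ D, ∫⁻ y in D, ‖rieszKernel x y‖ₑ ≤ ENNReal.ofReal B := by
  obtain ⟨R, hR⟩ := isBounded_iff.mp hD
  refine ⟨(∫⁻ z in ball (0 : Plane) (R + 1), ‖‖z‖⁻¹‖ₑ).toReal, by positivity, fun x hx => ?_⟩
  rw [ENNReal.ofReal_toReal (lintegral_ball_rieszKernel_lt_top _).ne,
    ← setLIntegral_ball_rieszKernel x]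
  refine lintegral_mono_set fun y hy => ?_
  have := hR hy hx
  rw [mem_ball]; linarith

lemma integrableOn_rieszKernel {D : Set Plane} (hD : Bornology.IsBounded D) {x : Plane}
    (hx : x ∈ D) : IntegrableOn (rieszKernel x) D := by
  obtain ⟨B, -, h⟩ := exists_lintegral_rieszKernel_le hD
  exact ⟨(measurable_rieszKernel.comp measurable_prodMk_left).aestronglyMeasurable,
    (h x hx).trans_lt ENNReal.ofReal_lt_top⟩

lemma rieszPotential_eq (D : Set Plane) (x : Plane) :
    rieszPotential D x = (∫⁻ y in D, ‖rieszKernel x y‖ₑ).toReal := by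
  have : ∀ y, 1 / ‖x - y‖ = ‖rieszKernel x y‖ := fun y => by simp [rieszKernel]
  simp only [rieszPotential, this]
  exact integral_norm_eq_lintegral_enorm
    (measurable_rieszKernel.comp measurable_prodMk_left).aestronglyMeasurable

lemma bddAbove_range_rieszPotential {D : Set Plane} (hD : Bornology.IsBounded D) :
    BddAbove (Set.range fun x : D => rieszPotential D x) := by
  obtain ⟨B, hB, h⟩ := exists_lintegral_rieszKernel_le hD
  refine ⟨B, ?_⟩
  rintro _ ⟨x, rfl⟩
  simp only [rieszPotential_eq]
  exact ENNReal.toReal_le_of_le_ofReal hB (h x x.2)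

lemma lintegral_rieszKernel_le_iSup {D : Set Plane} (hD : Bornology.IsBounded D) {x : Plane}
    (hx : x ∈ D) :
    ∫⁻ y in D, ‖rieszKernel x y‖ₑ ≤ ENNReal.ofReal (⨆ x : D, rieszPotential D x) := by
  obtain ⟨B, -, h⟩ := exists_lintegral_rieszKernel_le hD
  rw [← ENNReal.ofReal_toReal ((h x hx).trans_lt ENNReal.ofReal_lt_top).ne, ← rieszPotential_eq]
  exact ENNReal.ofReal_le_ofReal (le_ciSup (bddAbove_range_rieszPotential hD) ⟨x, hx⟩)

/-- Covers empty `D`, where the real supremum is 0 by convention. -/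
lemma iSup_rieszPotential_nonneg (D : Set Plane) : 0 ≤ ⨆ x : D, rieszPotential D x :=
  Real.iSup_nonneg fun x => by rw [rieszPotential_eq]; positivity

end Potential

/-! ### Compactness by finite-rank approximation. -/

section Compactness

/-- The kernel `1 / max(|x - y|, r)`. -/
noncomputable def truncKernel (r : ℝ) (x y : Plane) : ℝ := (max ‖x - y‖ r)⁻¹

lemma measurable_truncKernel (r : ℝ) : Measurable (Function.uncurry (truncKernel r)) := by
  unfold truncKernel Function.uncurry; fun_prop

lemma truncKernel_nonneg {r : ℝ} (hr : 0 < r) (x y : Plane) : 0 ≤ truncKernel r x y :=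
  inv_nonneg.mpr (hr.le.trans (le_max_right _ _))

lemma truncKernel_le {r : ℝ} (hr : 0 < r) (x y : Plane) : truncKernel r x y ≤ r⁻¹ :=
  inv_anti₀ hr (le_max_right _ _)

lemma abs_truncKernel_sub_le {r : ℝ} (hr : 0 < r) (x y z : Plane) :
    |truncKernel r x y - truncKernel r x z| ≤ ‖y - z‖ / r ^ 2 := by
  have hy : r ≤ max ‖x - y‖ r := le_max_right _ _
  have hz : r ≤ max ‖x - z‖ r := le_max_right _ _
  have hd : |max ‖x - z‖ r - max ‖x - y‖ r| ≤ ‖y - z‖ := by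
    refine (abs_max_sub_max_le_abs _ _ _).trans ((abs_norm_sub_norm_le _ _).trans_eq ?_)
    congr 1; abel
  unfold truncKernel
  rw [inv_sub_inv (hr.trans_le hy).ne' (hr.trans_le hz).ne', abs_div, abs_mul,
    abs_of_pos (hr.trans_le hy), abs_of_pos (hr.trans_le hz), sq]
  gcongr

lemma abs_rieszKernel_sub_truncKernel_le {r : ℝ} (hr : 0 < r) {x y : Plane} (hxy : x ≠ y) :
    |rieszKernel x y - truncKernel r x y| ≤ (ball x r).indicator (rieszKernel x) y := by
  have h0 : 0 < ‖x - y‖ := norm_pos_iff.mpr (sub_ne_zero.mpr hxy)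
  by_cases h : y ∈ ball x r
  · rw [Set.indicator_of_mem h, abs_of_nonneg (sub_nonneg.mpr ?_)]
    · exact sub_le_self _ (truncKernel_nonneg hr x y)
    · exact inv_anti₀ h0 (le_max_left _ _)
  · rw [Set.indicator_of_notMem h]
    rw [mem_ball, dist_eq_norm, norm_sub_rev, not_lt] at h
    simp [rieszKernel, truncKernel, max_eq_left h]

/-- Points of a bounded set are approximated uniformly by the values of a simple function. -/
lemma exists_simpleFunc_dist_le {D : Set Plane} (hD : Bornology.IsBounded D) {δ : ℝ}
    (hδ : 0 < δ) : ∃ q : SimpleFunc Plane Plane, ∀ y ∈ D, ‖y - q y‖ ≤ δ := by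
  obtain ⟨t, ht, hDt⟩ := totallyBounded_iff.mp
    ((isCompact_of_isClosed_isBounded isClosed_closure hD.closure).totallyBounded.subset
      subset_closure) δ hδ
  let l := ht.toFinset.toList
  refine ⟨SimpleFunc.nearestPt (fun n => l.getD n 0) l.length, fun y hy => ?_⟩
  obtain ⟨z, hz, hyz⟩ := Set.mem_iUnion₂.mp (hDt hy)
  obtain ⟨k, hk, rfl⟩ := List.mem_iff_getElem.mp
    ((Finset.mem_toList.mpr (ht.mem_toFinset.mpr hz) : z ∈ l))
  have h := SimpleFunc.edist_nearestPt_le (fun n => l.getD n 0) y hk.le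
  rw [List.getD_eq_getElem _ _ hk, edist_dist, edist_dist, ENNReal.ofReal_le_ofReal_iff dist_nonneg] at h
  rw [norm_sub_rev, ← dist_eq_norm]
  refine h.trans ?_
  rw [dist_comm]; exact (mem_ball.mp hyz).le

variable {D : Set Plane}

/-- The integral operator whose kernel is a truncated kernel with quantized second variable is
compact. -/
lemma exists_isCompactOperator_truncKernel (hD : Bornology.IsBounded D) {r : ℝ} (hr : 0 < r)
    (q : SimpleFunc Plane Plane) :
    ∃ F : L2 D →L[ℂ] L2 D, IsCompactOperator F ∧
      IsIntegralOperator (volume.restrict D) (fun x y => truncKernel r x (q y)) F := by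
  have : IsFiniteMeasure (volume.restrict D) := ⟨by simpa using hD.measure_lt_top⟩
  have hm : ∀ z, MemLp (fun x => (truncKernel r x z : ℂ)) 2 (volume.restrict D) := fun z => by
    refine MemLp.of_bound ?_ r⁻¹ (ae_of_all _ fun x => ?_)
    · exact (Complex.measurable_ofReal.comp
        ((measurable_truncKernel r).comp measurable_prodMk_right)).aestronglyMeasurable
    · rw [Complex.norm_real, Real.norm_of_nonneg (truncKernel_nonneg hr x z)]
      exact truncKernel_le hr x z
  -- Quantizing `y` makes the operator a finite sum of rank-one terms: integrate `f` over a fibre of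
  -- `q`, then multiply by a bounded function of `x`.
  let φ : Plane → L2 D →L[ℂ] ℂ := fun z => innerSL ℂ
    (indicatorConstLp 2 (q.measurableSet_fiber z) (measure_ne_top _ _) (1 : ℂ))
  have hφ : ∀ z f, φ z f = ∫ y in q ⁻¹' {z}, f y ∂(volume.restrict D) := fun z f => by
    exact L2.inner_indicatorConstLp_one _ _ f
  refine ⟨∑ z ∈ q.range, (φ z).smulRight ((hm z).toLp), ?_, fun f => ?_⟩
  · change _ ∈ compactOperator (RingHom.id ℂ) (L2 D) (L2 D)
    refine Submodule.sum_mem _ fun z _ => ?_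
    change IsCompactOperator ((ContinuousLinearMap.toSpanSingleton ℂ (hm z).toLp) ∘ φ z)
    exact ((isCompactOperator_id (E := ℂ)).clm_comp
      (ContinuousLinearMap.toSpanSingleton ℂ (hm z).toLp)).comp_clm (φ z)
  · have hfi : Integrable f (volume.restrict D) := (Lp.memLp f).integrable (by norm_num)
    have hc : ∀ᵐ x ∂(volume.restrict D), ∀ z ∈ q.range,
        ((hm z).toLp : Plane → ℂ) x = (truncKernel r x z : ℂ) :=
      (ae_ball_iff q.range.countable_toSet).mpr fun z _ => (hm z).coeFn_toLp
    have hs : ∀ᵐ x ∂(volume.restrict D), (∑ z ∈ q.range, (φ z).smulRight ((hm z).toLp)) f x =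
        ∑ z ∈ q.range, φ z f * ((hm z).toLp : Plane → ℂ) x := by
      rw [_root_.sum_apply]
      filter_upwards [Lp.coeFn_finsetSum q.range fun z => (φ z).smulRight ((hm z).toLp) f,
        (ae_ball_iff q.range.countable_toSet).mpr fun z _ =>
          Lp.coeFn_smul (φ z f) ((hm z).toLp)] with x h1 h2
      rw [h1, Finset.sum_apply]
      exact Finset.sum_congr rfl fun z hz => h2 z hz
    have hterm : ∀ x z, Integrable ((q ⁻¹' {z}).indicator fun y => f y * (truncKernel r x z : ℂ))
        (volume.restrict D) := fun x z =>
      (hfi.mul_const _).indicator (q.measurableSet_fiber z)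
    have hsplit : ∀ x, (fun y => f y * (truncKernel r x (q y) : ℂ)) = fun y =>
        ∑ z ∈ q.range, (q ⁻¹' {z}).indicator (fun y => f y * (truncKernel r x z : ℂ)) y := by
      intro x; funext y
      rw [Finset.sum_eq_single (q y)]
      · simp
      · intro z _ hz
        exact Set.indicator_of_notMem (fun h => hz h.symm) _
      · intro h
        exact absurd (q.mem_range_self y) h
    filter_upwards [hc, hs] with x h1 h2
    rw [hsplit x]
    refine ⟨integrable_finsetSum _ fun z _ => hterm x z, ?_⟩
    rw [h2, integral_finsetSum _ fun z _ => hterm x z]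
    refine Finset.sum_congr rfl fun z hz => ?_
    rw [h1 z hz, integral_indicator (q.measurableSet_fiber z), integral_mul_const, hφ]

/-- Truncating at distance `r` costs at most the integral of the kernel over a ball of radius `r`;
quantizing `y` within `δ` costs at most `δ / r²` times the area of `D`. Both are made at most `ε /
4`. -/
lemma isCompactOperator_of_rieszKernel (hD : Bornology.IsBounded D)
    (hDm : NullMeasurableSet D volume) {S : L2 D →L[ℂ] L2 D}
    (hS : IsIntegralOperator (volume.restrict D) rieszKernel S) : IsCompactOperator S := by
  suffices S ∈ closure {F : L2 D →L[ℂ] L2 D | IsCompactOperator F} by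
    rwa [isClosed_setOfPred_isCompactOperator.closure_eq] at this
  rw [Metric.mem_closure_iff]
  intro ε hε
  have hfin : volume D < ∞ := hD.measure_lt_top
  obtain ⟨r, hr, hJ⟩ := exists_lintegral_ball_le (ε := ENNReal.ofReal (ε / 4)) (by simpa using hε)
  obtain ⟨δ, hδ, hδε⟩ : ∃ δ : ℝ, 0 < δ ∧ δ / r ^ 2 * volume.real D ≤ ε / 4 := by
    -- The `+ 1` keeps the denominator positive when `D` is null.
    refine ⟨ε / 4 * r ^ 2 / (volume.real D + 1), by positivity, ?_⟩
    rw [div_mul_eq_mul_div, div_le_iff₀ (by positivity), div_mul_eq_mul_div,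
      div_le_iff₀ (by positivity)]
    have : 0 ≤ volume.real D := measureReal_nonneg
    nlinarith [mul_pos hε (pow_pos hr 2)]
  obtain ⟨q, hq⟩ := exists_simpleFunc_dist_le hD hδ
  obtain ⟨F, hF, hFi⟩ := exists_isCompactOperator_truncKernel hD hr q
  refine ⟨F, hF, ?_⟩
  have hpt : ∀ x y, x ≠ y → y ∈ D → ‖rieszKernel x y - truncKernel r x (q y)‖ₑ ≤
      (ball x r).indicator (fun y => ‖rieszKernel x y‖ₑ) y + ENNReal.ofReal (δ / r ^ 2) := by
    intro x y hxy hy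
    have h1 := abs_rieszKernel_sub_truncKernel_le hr hxy
    have h2 := (abs_truncKernel_sub_le hr x y (q y)).trans
      (div_le_div_of_nonneg_right (hq y hy) (by positivity))
    have h3 := (abs_sub_le (rieszKernel x y) (truncKernel r x y)
      (truncKernel r x (q y))).trans (add_le_add h1 h2)
    rw [← ofReal_norm, Real.norm_eq_abs]
    refine (ENNReal.ofReal_le_ofReal h3).trans (ENNReal.ofReal_add_le.trans ?_)
    gcongr
    by_cases h : y ∈ ball x r <;> simp [h, ← ofReal_norm, le_abs_self]
  have hint : ∀ x, ∫⁻ y in D, ((ball x r).indicator (fun y => ‖rieszKernel x y‖ₑ) y +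
      ENNReal.ofReal (δ / r ^ 2)) ≤ ENNReal.ofReal (ε / 2) := by
    intro x
    rw [lintegral_add_right _ measurable_const, lintegral_const, Measure.restrict_apply_univ,
      show ε / 2 = ε / 4 + ε / 4 by ring, ENNReal.ofReal_add (by positivity) (by positivity)]
    refine add_le_add ((setLIntegral_le_lintegral _ _).trans ?_) ?_
    · rw [lintegral_indicator measurableSet_ball, setLIntegral_ball_rieszKernel]
      exact hJ
    · rw [← ENNReal.ofReal_toReal hfin.ne, ← ENNReal.ofReal_mul (by positivity)]
      exact ENNReal.ofReal_le_ofReal hδε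
  have hmem : ∀ᵐ y ∂(volume.restrict D), y ∈ D := ae_restrict_mem₀ hDm
  have hne : ∀ x : Plane, ∀ᵐ y ∂(volume.restrict D), x ≠ y := fun x =>
    ae_restrict_of_ae (by simpa [ne_comm] using Measure.ae_ne volume x)
  have hle : ‖S - F‖ ≤ ε / 2 := by
    have hq' : Measurable fun p : Plane × Plane => truncKernel r p.1 (q p.2) := by
      have := q.measurable
      unfold truncKernel; fun_prop
    have hkm : Measurable (Function.uncurry fun x y => rieszKernel x y - truncKernel r x (q y)) :=
      measurable_rieszKernel.sub hq'
    refine (hS.sub hFi).norm_le hkm (by positivity) ?_ ?_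
    · refine ae_of_all _ fun x => (lintegral_mono_ae ?_).trans (hint x)
      filter_upwards [hmem, hne x] with y hy hxy using hpt x y hxy hy
    -- Only `y` is quantized, but the pointwise bound is symmetric in `x` and `y`, so the row
    -- estimate applies with centre `y`.
    · filter_upwards [hmem] with y hy
      refine (lintegral_mono_ae ?_).trans (hint y)
      filter_upwards [hne y] with x hxy
      refine (hpt x y hxy.symm hy).trans_eq ?_
      simp only [Set.indicator, mem_ball, dist_comm y x, rieszKernel_comm y x]
  rw [dist_eq_norm]
  linarith

end Compactness

end RieszFourier

namespace RieszFourier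

open Complex Set

/-! ### Gaussian subordination of `|ξ|⁻¹` and `|x|⁻¹`. -/

section Subordination

/-- Also true at `r = 0`: the divergent integral and the inverse are both 0 by convention. -/
lemma integral_exp_neg_sq_mul_sq (r : ℝ) :
    ∫ u in Ioi (0 : ℝ), Real.exp (-(u ^ 2 * r ^ 2)) = √Real.pi / 2 * |r|⁻¹ := by
  have h := integral_gaussian_Ioi (r ^ 2)
  rw [Real.sqrt_div Real.pi_pos.le, Real.sqrt_sq_eq_abs] at h
  rw [show √Real.pi / 2 * |r|⁻¹ = √Real.pi / |r| / 2 by ring, ← h]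
  refine integral_congr_ae (ae_of_all _ fun u => ?_)
  ring_nf

/-- The Fourier transform of the Gaussian `exp (-u² |ξ|²)` in the plane, at distance `r`. -/
noncomputable def heatProfile (r u : ℝ) : ℝ :=
  Real.pi / u ^ 2 * Real.exp (-(r ^ 2 / (4 * u ^ 2)))

lemma heatProfile_nonneg (r u : ℝ) : 0 ≤ heatProfile r u := by
  unfold heatProfile; positivity

/-- Prepares the substitution `v = u⁻¹`: its Jacobian `u⁻²` absorbs the prefactor and leaves a
Gaussian in `v`. -/
lemma heatProfile_eq (r : ℝ) {u : ℝ} (hu : u ∈ Ioi (0 : ℝ)) :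
    heatProfile r u = (|(-1 : ℝ)| * u ^ ((-1 : ℝ) - 1)) •
      (fun v => Real.pi * Real.exp (-(r ^ 2 / 4) * v ^ 2)) (u ^ (-1 : ℝ)) := by
  have h2 : u ^ ((-1 : ℝ) - 1) = (u ^ 2)⁻¹ := by
    rw [show ((-1 : ℝ) - 1) = -(2 : ℕ) by norm_num, Real.rpow_neg (le_of_lt hu), Real.rpow_natCast]
  rw [h2, Real.rpow_neg_one, smul_eq_mul, heatProfile, abs_neg, abs_one, one_mul]
  have : -(r ^ 2 / (4 * u ^ 2)) = -(r ^ 2 / 4) * u⁻¹ ^ 2 := by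
    have := (ne_of_gt hu : u ≠ 0)
    field_simp
  rw [this]; ring

lemma integrableOn_heatProfile {r : ℝ} (hr : 0 < r) : IntegrableOn (heatProfile r) (Ioi 0) := by
  rw [integrableOn_congr_fun (fun u hu => heatProfile_eq r hu) measurableSet_Ioi,
    integrableOn_Ioi_comp_rpow_iff (fun v => Real.pi * Real.exp (-(r ^ 2 / 4) * v ^ 2))
      (by norm_num : (-1 : ℝ) ≠ 0)]
  exact ((integrable_exp_neg_mul_sq (by positivity)).const_mul _).integrableOn

lemma integral_heatProfile {r : ℝ} (hr : 0 < r) :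
    ∫ u in Ioi 0, heatProfile r u = Real.pi * √Real.pi * r⁻¹ := by
  rw [setIntegral_congr_fun measurableSet_Ioi (fun u hu => heatProfile_eq r hu),
    integral_comp_rpow_Ioi (fun v => Real.pi * Real.exp (-(r ^ 2 / 4) * v ^ 2))
      (by norm_num : (-1 : ℝ) ≠ 0), integral_const_mul, integral_gaussian_Ioi,
    show Real.pi / (r ^ 2 / 4) = Real.pi / (r / 2) ^ 2 by ring, Real.sqrt_div Real.pi_pos.le,
    Real.sqrt_sq (by positivity)]
  field_simp

lemma integral_gaussian_mul_exp_inner {u : ℝ} (hu : 0 < u) (w : Plane) :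
    ∫ ξ : Plane, (Real.exp (-(u ^ 2 * ‖ξ‖ ^ 2)) : ℂ) * cexp (I * (inner ℝ w ξ : ℝ)) =
      heatProfile ‖w‖ u := by
  have h := GaussianFourier.integral_cexp_neg_mul_sq_norm_add (V := Plane) (b := (u : ℂ) ^ 2)
    (by rw [← ofReal_pow, ofReal_re]; positivity) I w
  have e : (Module.finrank ℝ Plane / 2 : ℂ) = 1 := by simp
  rw [e, cpow_one] at h
  simp only [heatProfile]
  push_cast
  refine Eq.trans (integral_congr_ae (ae_of_all _ fun ξ => ?_)) (h.trans ?_)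
  · simp only [← Complex.exp_add]; congr 1; ring
  · congr 2; simp [div_eq_mul_inv]

end Subordination

/-! ### The energy identity. -/

section Energy

variable {μ : Measure Plane} {f : Plane → ℂ}

/-- The unnormalized Fourier transform of the measure `f μ`. -/
noncomputable def fourierOf (μ : Measure Plane) (f : Plane → ℂ) (ξ : Plane) : ℂ :=
  ∫ x, cexp (-I * (inner ℝ x ξ : ℝ)) * f x ∂μ

/-- The density `f(x) conj f(y)`. -/
noncomputable def tensorConj (f : Plane → ℂ) (p : Plane × Plane) : ℂ :=
  f p.1 * starRingEnd ℂ (f p.2)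

lemma integrable_tensorConj [SFinite μ] (hf : Integrable f μ) :
    Integrable (tensorConj f) (μ.prod μ) :=
  hf.mul_prod (conjCLE.toContinuousLinearMap.integrable_comp hf)

lemma norm_sq_fourierOf [SFinite μ] (ξ : Plane) :
    ((‖fourierOf μ f ξ‖ ^ 2 : ℝ) : ℂ) =
      ∫ p, tensorConj f p * cexp (I * (inner ℝ (p.2 - p.1) ξ : ℝ)) ∂(μ.prod μ) := by
  rw [ofReal_pow, ← Complex.mul_conj', fourierOf, ← integral_conj,
    ← integral_prod_mul]
  refine integral_congr_ae (ae_of_all _ fun p => ?_)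
  simp only [tensorConj, map_mul, ← Complex.exp_conj, map_neg, conj_I, conj_ofReal, inner_sub_left,
    ofReal_sub]
  rw [show I * ((inner ℝ p.2 ξ : ℝ) - (inner ℝ p.1 ξ : ℝ) : ℂ) =
    -I * (inner ℝ p.1 ξ : ℝ) + - -I * (inner ℝ p.2 ξ : ℝ) by ring, Complex.exp_add]
  ring

lemma integrable_gaussian_plane {u : ℝ} (hu : 0 < u) :
    Integrable fun ξ : Plane => (Real.exp (-(u ^ 2 * ‖ξ‖ ^ 2)) : ℂ) := by
  have h := GaussianFourier.integrable_cexp_neg_mul_sq_norm_add (V := Plane) (b := (u : ℂ) ^ 2)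
    (by rw [← ofReal_pow, ofReal_re]; positivity) 0 0
  refine h.congr (ae_of_all _ fun ξ => ?_)
  simp

/-- The Gaussian supplies the decay in `ξ` that Fubini needs. -/
lemma integrable_gaussian_tensor [SFinite μ] (hf : Integrable f μ) {u : ℝ} (hu : 0 < u) :
    Integrable (Function.uncurry fun (ξ : Plane) (p : Plane × Plane) =>
      (Real.exp (-(u ^ 2 * ‖ξ‖ ^ 2)) : ℂ) *
        (tensorConj f p * cexp (I * (inner ℝ (p.2 - p.1) ξ : ℝ))))
      (volume.prod (μ.prod μ)) := by
  have h := (integrable_gaussian_plane hu).mul_prod (integrable_tensorConj hf)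
  have h2 := h.bdd_mul (c := 1)
    (f := fun z : Plane × Plane × Plane => cexp (I * (inner ℝ (z.2.2 - z.2.1) z.1 : ℝ)))
    (Continuous.aestronglyMeasurable (by fun_prop))
    (ae_of_all _ fun z => by rw [mul_comm, norm_exp_ofReal_mul_I])
  refine h2.congr (ae_of_all _ fun z => ?_)
  simp only [Function.uncurry]; ring

lemma gaussian_mul_norm_sq_fourierOf [SFinite μ] (u : ℝ) (ξ : Plane) :
    ((‖fourierOf μ f ξ‖ ^ 2 * Real.exp (-(u ^ 2 * ‖ξ‖ ^ 2)) : ℝ) : ℂ) =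
      ∫ p, (Real.exp (-(u ^ 2 * ‖ξ‖ ^ 2)) : ℂ) *
        (tensorConj f p * cexp (I * (inner ℝ (p.2 - p.1) ξ : ℝ))) ∂(μ.prod μ) := by
  rw [integral_const_mul, ← norm_sq_fourierOf, ofReal_mul, mul_comm]

lemma integrable_gaussian_mul_norm_sq_fourierOf [SFinite μ] (hf : Integrable f μ) {u : ℝ}
    (hu : 0 < u) :
    Integrable fun ξ => ‖fourierOf μ f ξ‖ ^ 2 * Real.exp (-(u ^ 2 * ‖ξ‖ ^ 2)) := by
  have h := (integrable_gaussian_tensor hf hu).integral_prod_left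
  simp only [Function.uncurry, ← gaussian_mul_norm_sq_fourierOf] at h
  exact h.re

lemma integral_gaussian_mul_norm_sq_fourierOf [SFinite μ] (hf : Integrable f μ) {u : ℝ}
    (hu : 0 < u) :
    ((∫ ξ, ‖fourierOf μ f ξ‖ ^ 2 * Real.exp (-(u ^ 2 * ‖ξ‖ ^ 2)) : ℝ) : ℂ) =
      ∫ p, tensorConj f p * (heatProfile ‖p.1 - p.2‖ u : ℂ) ∂(μ.prod μ) := by
  rw [← integral_complex_ofReal]
  simp only [gaussian_mul_norm_sq_fourierOf]
  rw [integral_integral_swap (integrable_gaussian_tensor hf hu)]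
  refine integral_congr_ae (ae_of_all _ fun p => ?_)
  simp only
  rw [norm_sub_rev, ← integral_gaussian_mul_exp_inner hu, ← integral_const_mul]
  refine integral_congr_ae (ae_of_all _ fun ξ => ?_)
  simp only; ring

/-- Integrating the absolute value in `u` first gives a multiple of the Riesz integrand, integrable
by `hk`. The diagonal is excluded because there the `u`-integral diverges. -/
lemma integrable_tensorConj_mul_heatProfile [SFinite μ] (hf : Integrable f μ)
    (hdiag : ∀ᵐ p ∂(μ.prod μ), p.1 ≠ p.2)
    (hk : Integrable (fun p => tensorConj f p * (rieszKernel p.1 p.2 : ℂ)) (μ.prod μ)) :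
    Integrable (Function.uncurry fun (u : ℝ) (p : Plane × Plane) =>
      tensorConj f p * (heatProfile ‖p.1 - p.2‖ u : ℂ))
      ((volume.restrict (Ioi 0)).prod (μ.prod μ)) := by
  have hm : AEStronglyMeasurable (Function.uncurry fun (u : ℝ) (p : Plane × Plane) =>
      tensorConj f p * (heatProfile ‖p.1 - p.2‖ u : ℂ))
      ((volume.restrict (Ioi 0)).prod (μ.prod μ)) := by
    refine (integrable_tensorConj hf).1.comp_snd.mul (Measurable.aestronglyMeasurable ?_)
    unfold heatProfile; fun_prop
  have hpos : ∀ᵐ p ∂(μ.prod μ), 0 < ‖p.1 - p.2‖ :=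
    hdiag.mono fun p hp => norm_pos_iff.mpr (sub_ne_zero.mpr hp)
  rw [integrable_prod_iff' hm]
  refine ⟨hpos.mono fun p hp => ?_, ?_⟩
  · exact ((integrableOn_heatProfile hp).ofReal (𝕜 := ℂ)).const_mul (tensorConj f p)
  refine (hk.norm.const_mul (Real.pi * √Real.pi)).congr (hpos.mono fun p hp => ?_)
  simp only [Function.uncurry, norm_mul, norm_real, Real.norm_eq_abs,
    abs_of_nonneg (heatProfile_nonneg _ _)]
  rw [integral_const_mul, integral_heatProfile hp, rieszKernel, abs_of_nonneg (by positivity)]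
  ring

/-- The integrand is nonnegative, so its `ξ`-integral equals the heat-kernel double integral,
already known to be integrable in `u`. -/
lemma integrable_norm_sq_fourierOf_gaussian_prod [SFinite μ] (hf : Integrable f μ)
    (hdiag : ∀ᵐ p ∂(μ.prod μ), p.1 ≠ p.2)
    (hk : Integrable (fun p => tensorConj f p * (rieszKernel p.1 p.2 : ℂ)) (μ.prod μ)) :
    Integrable (Function.uncurry fun (ξ : Plane) (u : ℝ) =>
      ‖fourierOf μ f ξ‖ ^ 2 * Real.exp (-(u ^ 2 * ‖ξ‖ ^ 2)))
      (volume.prod (volume.restrict (Ioi 0))) := by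
  have ha : AEStronglyMeasurable (fourierOf μ f) volume := by
    have : AEStronglyMeasurable (fun z : Plane × Plane => cexp (-I * (inner ℝ z.2 z.1 : ℝ)) * f z.2)
        (volume.prod μ) :=
      (Continuous.aestronglyMeasurable (by fun_prop)).mul hf.1.comp_snd
    exact this.integral_prod_right'
  have hm : AEStronglyMeasurable (Function.uncurry fun (ξ : Plane) (u : ℝ) =>
      ‖fourierOf μ f ξ‖ ^ 2 * Real.exp (-(u ^ 2 * ‖ξ‖ ^ 2)))
      (volume.prod (volume.restrict (Ioi 0))) :=
    (ha.norm.pow 2).comp_fst.mul (Continuous.aestronglyMeasurable (by fun_prop))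
  rw [integrable_prod_iff' hm]
  have hpos : ∀ᵐ u ∂(volume.restrict (Ioi (0 : ℝ))), 0 < u := ae_restrict_mem measurableSet_Ioi
  refine ⟨hpos.mono fun u hu => integrable_gaussian_mul_norm_sq_fourierOf hf hu, ?_⟩
  have h := (integrable_tensorConj_mul_heatProfile hf hdiag hk).integral_prod_left.re
  refine h.congr (hpos.mono fun u hu => ?_)
  simp only [Function.uncurry]
  rw [← integral_gaussian_mul_norm_sq_fourierOf hf hu]
  simp only [RCLike.re_to_complex, ofReal_re]
  refine integral_congr_ae (ae_of_all _ fun ξ => ?_)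
  exact (Real.norm_of_nonneg (by positivity)).symm

/-- The energy identity for the weight `|ξ|⁻¹`, whose Fourier transform in the plane is a multiple
of `|x|⁻¹`. -/
lemma integrable_and_integral_norm_sq_fourierOf [SFinite μ] (hf : Integrable f μ)
    (hdiag : ∀ᵐ p ∂(μ.prod μ), p.1 ≠ p.2)
    (hk : Integrable (fun p => tensorConj f p * (rieszKernel p.1 p.2 : ℂ)) (μ.prod μ)) :
    Integrable (fun ξ => ‖fourierOf μ f ξ‖ ^ 2 / ‖ξ‖) ∧
      ((∫ ξ, ‖fourierOf μ f ξ‖ ^ 2 / ‖ξ‖ : ℝ) : ℂ) =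
        2 * Real.pi * ∫ p, tensorConj f p * (rieszKernel p.1 p.2 : ℂ) ∂(μ.prod μ) := by
  have hH := integrable_norm_sq_fourierOf_gaussian_prod hf hdiag hk
  have hu : ∀ ξ, ∫ u in Ioi (0 : ℝ), ‖fourierOf μ f ξ‖ ^ 2 * Real.exp (-(u ^ 2 * ‖ξ‖ ^ 2)) =
      √Real.pi / 2 * (‖fourierOf μ f ξ‖ ^ 2 / ‖ξ‖) := fun ξ => by
    rw [integral_const_mul, integral_exp_neg_sq_mul_sq, abs_norm]; ring
  have hs : √Real.pi ≠ 0 := (Real.sqrt_pos.mpr Real.pi_pos).ne'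
  have hI := hH.integral_prod_left
  simp only [Function.uncurry, hu] at hI
  refine ⟨(integrable_const_mul_iff (IsUnit.mk0 _ (by positivity)) _).mp hI, ?_⟩
  have h1 := integral_integral_swap hH
  simp only [hu] at h1
  rw [integral_const_mul] at h1
  have h2 : ((∫ u in Ioi (0 : ℝ), ∫ ξ, ‖fourierOf μ f ξ‖ ^ 2 * Real.exp (-(u ^ 2 * ‖ξ‖ ^ 2)) : ℝ)
      : ℂ) = Real.pi * √Real.pi * ∫ p, tensorConj f p * (rieszKernel p.1 p.2 : ℂ) ∂(μ.prod μ) := by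
    rw [← integral_complex_ofReal, setIntegral_congr_fun measurableSet_Ioi
      (fun u hu => integral_gaussian_mul_norm_sq_fourierOf hf hu),
      integral_integral_swap (integrable_tensorConj_mul_heatProfile hf hdiag hk),
      ← integral_const_mul]
    refine integral_congr_ae (hdiag.mono fun p hp => ?_)
    simp only
    rw [integral_const_mul, integral_complex_ofReal,
      integral_heatProfile (norm_pos_iff.mpr (sub_ne_zero.mpr hp)), rieszKernel]
    push_cast; ring
  rw [← h1] at h2
  push_cast at h2
  have hs' : (√Real.pi : ℂ) ≠ 0 := ofReal_ne_zero.mpr hs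
  -- The constant is `π √π / (√π / 2) = 2π`.
  refine mul_left_cancel₀ (div_ne_zero hs' two_ne_zero) (h2.trans ?_)
  ring

end Energy

end RieszFourier

namespace RieszFourier

open scoped ENNReal

/-! ### The norm as an eigenvalue. -/

section Spectral

variable {H : Type*} [NormedAddCommGroup H] [InnerProductSpace ℂ H] [CompleteSpace H]

/-- The norm of a compact positive operator is an eigenvalue. -/
lemma hasEigenvalue_norm [Nontrivial H] {S : H →L[ℂ] H} (hS : S.IsPositive)
    (hc : IsCompactOperator S) :
    Module.End.HasEigenvalue (S : H →ₗ[ℂ] H) ((‖S‖ : ℝ) : ℂ) := by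
  rcases eq_or_ne S 0 with rfl | h0
  · obtain ⟨v, hv⟩ := exists_ne (0 : H)
    refine Module.End.hasEigenvalue_of_hasEigenvector (x := v)
      ⟨Module.End.mem_eigenspace_iff.mpr ?_, hv⟩
    simp
  · have hn : ((‖S‖ : ℝ) : ℂ) ≠ 0 := by simpa using h0
    -- A nonzero spectral value of a compact operator is an eigenvalue, and the norm of a positive
    -- element of a C⋆-algebra lies in its spectrum.
    refine (hc.hasEigenvalue_iff_mem_spectrum hn).mpr ?_
    exact spectrum.algebraMap_mem ℂ (CStarAlgebra.norm_mem_spectrum_of_nonneg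
      ((ContinuousLinearMap.nonneg_iff_isPositive S).mpr hS))

end Spectral

/-! ### Translation to the stated definitions, and the theorem. -/

variable {D : Set Plane}

lemma isIntegralOperator_rieszKernel_iff {S : L2 D →L[ℂ] L2 D} :
    IsIntegralOperator (volume.restrict D) rieszKernel S ↔ IsRieszOperator D S := by
  have e : ∀ (f : L2 D) (x : Plane), (fun y => f y * (rieszKernel x y : ℂ)) =
      fun y => f y / (‖x - y‖ : ℂ) := fun f x => by
    funext y; simp [rieszKernel, div_eq_mul_inv]
  simp only [IsIntegralOperator, IsRieszOperator, e, IntegrableOn]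

lemma fourier_zeroExt (hDm : NullMeasurableSet D volume) (f : L2 D) (ξ : Plane) :
    fourier (zeroExt D f) ξ = (1 / (2 * Real.pi) : ℂ) * fourierOf (volume.restrict D) f ξ := by
  rw [fourier, fourierOf, ← integral_indicator₀ hDm]
  congr 2
  funext x
  by_cases hx : x ∈ D <;> simp [zeroExt, hx]

lemma energyDensity_eq (hDm : NullMeasurableSet D volume) (f : L2 D) :
    energyDensity D f = fun ξ =>
      (1 / (2 * Real.pi)) ^ 2 * (‖fourierOf (volume.restrict D) f ξ‖ ^ 2 / ‖ξ‖) := by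
  funext ξ
  have : ‖(1 / (2 * Real.pi) : ℂ)‖ = 1 / (2 * Real.pi) := by
    simp [abs_of_pos Real.pi_pos]
  rw [energyDensity, fourier_zeroExt hDm, norm_mul, this, mul_pow, mul_div_assoc]

lemma ae_prod_ne (D : Set Plane) :
    ∀ᵐ p ∂((volume.restrict D).prod (volume.restrict D)), p.1 ≠ p.2 := by
  have hd : MeasurableSet {p : Plane × Plane | p.1 ≠ p.2} :=
    (measurableSet_eq_fun measurable_fst measurable_snd).compl
  rw [Measure.ae_prod_iff_ae_ae hd]
  exact ae_of_all _ fun x => ae_restrict_of_ae (by simpa [ne_comm] using Measure.ae_ne volume x)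

end RieszFourier

theorem mainTheorem4 (D : Set RieszFourier.Plane) (hD : Bornology.IsBounded D)
    (hDm : MeasureTheory.NullMeasurableSet D MeasureTheory.volume) :
    ∃ S : RieszFourier.L2 D →L[ℂ] RieszFourier.L2 D,
      RieszFourier.IsRieszOperator D S ∧
      -- `S` is positive, self-adjoint and compact
      S.IsPositive ∧ IsSelfAdjoint S ∧ IsCompactOperator S ∧
      -- the quadratic form identity
      (∀ f : RieszFourier.L2 D,
        MeasureTheory.Integrable (RieszFourier.energyDensity D f) ∧
        ((∫ ξ, RieszFourier.energyDensity D f ξ : ℝ) : ℂ) =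
          (1 / (2 * Real.pi) : ℂ) * inner ℂ (S f) f) ∧
      -- the sharp constant is the norm, which is the largest eigenvalue if `L²(D) ≠ 0`
      RieszFourier.IsSharpConstant D (1 / (2 * Real.pi) * ‖S‖) ∧
      (MeasureTheory.volume D ≠ 0 → RieszFourier.IsMaxEigenvalue S ‖S‖) ∧
      -- the bound by the supremum of the potential, a supremum of finite integrals that is finite
      (∀ x ∈ D, MeasureTheory.IntegrableOn (fun y : RieszFourier.Plane => 1 / ‖x - y‖) D) ∧
      BddAbove (Set.range fun x : D => RieszFourier.rieszPotential D x) ∧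
      1 / (2 * Real.pi) * ‖S‖ ≤
        1 / (2 * Real.pi) * ⨆ x : D, RieszFourier.rieszPotential D x := by
  open RieszFourier in
  have : IsFiniteMeasure (volume.restrict D) := ⟨by simpa using hD.measure_lt_top⟩
  have hM := iSup_rieszPotential_nonneg D
  have hrow : ∀ᵐ x ∂(volume.restrict D), ∫⁻ y in D, ‖rieszKernel x y‖ₑ ≤
      ENNReal.ofReal (⨆ x : D, rieszPotential D x) :=
    (ae_restrict_mem₀ hDm).mono fun x hx => lintegral_rieszKernel_le_iSup hD hx
  have hcol : ∀ᵐ y ∂(volume.restrict D), ∫⁻ x in D, ‖rieszKernel x y‖ₑ ≤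
      ENNReal.ofReal (⨆ x : D, rieszPotential D x) := by
    simpa only [rieszKernel_comm] using hrow
  obtain ⟨S, hS⟩ := exists_isIntegralOperator measurable_rieszKernel hM hrow hcol
  have hform : ∀ f : L2 D, Integrable (energyDensity D f) ∧
      ((∫ ξ, energyDensity D f ξ : ℝ) : ℂ) = (1 / (2 * Real.pi) : ℂ) * inner ℂ (S f) f := by
    intro f
    obtain ⟨h1, h2⟩ := integrable_and_integral_norm_sq_fourierOf
      ((Lp.memLp f).integrable (by norm_num)) (ae_prod_ne D)
      (integrable_prod_mul_kernel measurable_rieszKernel hrow hcol f)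
    rw [energyDensity_eq hDm]
    refine ⟨h1.const_mul _, ?_⟩
    rw [integral_const_mul, Complex.ofReal_mul, h2,
      hS.inner_eq measurable_rieszKernel hrow hcol f]
    have hpi : (Real.pi : ℂ) ≠ 0 := Complex.ofReal_ne_zero.mpr Real.pi_ne_zero
    simp only [tensorConj]
    push_cast
    field_simp
  have hreal : ∀ f : L2 D, inner ℂ (S f) f =
      ((2 * Real.pi * ∫ ξ, energyDensity D f ξ : ℝ) : ℂ) := fun f => by
    have hpi : (Real.pi : ℂ) ≠ 0 := Complex.ofReal_ne_zero.mpr Real.pi_ne_zero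
    rw [Complex.ofReal_mul, (hform f).2]
    push_cast
    field_simp
  have hnn : ∀ f : L2 D, 0 ≤ ∫ ξ, energyDensity D f ξ := fun f =>
    integral_nonneg fun ξ => by simp only [energyDensity, Pi.zero_apply]; positivity
  have hpos : S.IsPositive := by
    rw [ContinuousLinearMap.isPositive_iff_complex]
    intro f
    rw [hreal f]
    refine ⟨by simp, ?_⟩
    have := hnn f
    rw [RCLike.re_to_complex, Complex.ofReal_re]
    positivity
  have hcpt := isCompactOperator_of_rieszKernel hD hDm hS
  have hnontriv : volume D ≠ 0 → Nontrivial (L2 D) := fun h0 => by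
    refine ⟨⟨indicatorConstLp 2 MeasurableSet.univ (measure_ne_top _ _) (1 : ℂ), 0, fun h => ?_⟩⟩
    have := congrArg norm h
    rw [norm_indicatorConstLp (by norm_num) (by norm_num), norm_zero] at this
    simp [Measure.real, ENNReal.toReal_eq_zero_iff, h0, hD.measure_lt_top.ne] at this
  have hmax : volume D ≠ 0 → IsMaxEigenvalue S ‖S‖ := fun h0 => by
    have := hnontriv h0
    refine ⟨hasEigenvalue_norm hpos hcpt, fun t ht => ?_⟩
    obtain ⟨v, hv⟩ := Module.End.HasEigenvalue.exists_hasEigenvector ht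
    have hSv : S v = (t : ℂ) • v := hv.apply_eq_smul
    have h := S.le_opNorm v
    rw [hSv, norm_smul, Complex.norm_real] at h
    exact (le_abs_self t).trans (le_of_mul_le_mul_right h (norm_pos_iff.mpr hv.2))
  have hpi := Real.pi_pos
  refine ⟨S, isIntegralOperator_rieszKernel_iff.mp hS, hpos, hpos.isSelfAdjoint, hcpt, hform,
    ⟨⟨by positivity, fun f => ⟨(hform f).1, ?_⟩⟩, fun C hC => ?_⟩, hmax, fun x hx => ?_,
    bddAbove_range_rieszPotential hD, ?_⟩
  · have h1 : ‖inner ℂ (S f) f‖ ≤ ‖S‖ * ‖f‖ ^ 2 :=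
      (norm_inner_le_norm _ _).trans (by rw [sq, ← mul_assoc]; gcongr; exact S.le_opNorm f)
    rw [hreal f, Complex.norm_real, Real.norm_of_nonneg (by have := hnn f; positivity)] at h1
    rw [mul_assoc, one_div, inv_mul_eq_div, le_div_iff₀ (by positivity)]
    linarith
  -- For null `D` there is no eigenvector; `S = 0`, and minimality is the constraint `0 ≤ C`.
  -- Otherwise an eigenvector for `‖S‖` is the test function.
  · by_cases h0 : volume D = 0
    · have hsub : ∀ f : L2 D, f = 0 := fun f => by
        have : ae (volume.restrict D) = ⊥ := by rw [Measure.restrict_eq_zero.mpr h0, ae_zero]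
        refine Lp.ext ?_
        rw [Filter.EventuallyEq, this]
        exact Filter.eventually_bot
      have : S = 0 := ContinuousLinearMap.ext fun f => hsub _
      rw [this, norm_zero, mul_zero]
      exact hC.1
    · obtain ⟨v, hv⟩ := Module.End.HasEigenvalue.exists_hasEigenvector (hmax h0).1
      have hSv : S v = ((‖S‖ : ℝ) : ℂ) • v := hv.apply_eq_smul
      have hvpos : 0 < ‖v‖ := norm_pos_iff.mpr hv.2
      have h1 := hreal v
      rw [hSv, inner_smul_left, inner_self_eq_norm_sq_to_K, Complex.conj_ofReal] at h1
      have h2 : ‖S‖ * ‖v‖ ^ 2 = 2 * Real.pi * ∫ ξ, energyDensity D v ξ := by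
        rw [← Complex.ofReal_inj, ← h1]
        simp
      have h3 := (hC.2 v).2
      refine le_of_mul_le_mul_right (le_trans (le_of_eq ?_) h3) (pow_pos hvpos 2)
      rw [mul_assoc, h2]
      field_simp
  · simpa only [one_div] using! integrableOn_rieszKernel hD hx
  · gcongr
    exact hS.norm_le measurable_rieszKernel hM hrow hcol
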